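/- **Setting.** Let $T\ge 1$ be an integer, $p_l>0$ $(l\in\mathbb N)$ with $\sum_{l=1}^\infty p_l=1$, $\theta_l\in\mathbb C$ with $\sup_l|\theta_l|<\infty$, and $b_1,\varphi_0,\varphi_1\in\mathbb C$. Let $\mathcal T$ be the rooted tree with $T$ tiers of edges of length $1$ in which exactly one edge $e_1$ (tier $1$) leaves the root and, for every edge $e_j$ of tier $k<T$, countably many edges $e_{\nu_{j,l}}$ $(l\in\mathbb N)$ of tier $k+1$ leave its end point $v_j$. The end points $v_j$ of edges of tier less than $T$ are the internal vertices, those of edges of tier $T$ are the boundary vertices other than the root. For an internal vertex $v_j$ put $V_j=\{\nu_{j,l}\}_{l\in\mathbb N}$, $b_{\nu_{j,l}}=\theta_l$, $\tilde p_{\nu_{j,l}}=p_l$, and let $\alpha_1=1$ and $\alpha_\nu=\tilde p_\nu\alpha_j$ for $\nu\in V_j$. Each edge is parametrized by $t\in[0,1]$, with $t=1$ at its end point. For $s=1,2$ let $W^s_{2,\alpha}$ be the space of tuples $y=[y_j]$ of complex-valued functions $y_j\in W_2^s[0,1]$, one for each edge, with $\sum_j\alpha_j\|y_j\|^2_{W_2^s[0,1]}<\infty$.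 Consider the conditions $$(1)\quad y_1(0)=\varphi_0;\qquad (2)\quad y_j(1)=y_\nu(0)\ \text{ for every internal vertex } v_j \text{ and } \nu\in V_j;\qquad (3)\quad y_j(1)=\varphi_1\ \text{ for every boundary vertex } v_j \text{ other than the root.}$$ *Problem $\mathcal V$*: minimize $$J(y)=\sum_{j}\alpha_j\int_0^1|y_j'(t)+b_jy_j(t)|^2\,dt$$ over all $y\in W^1_{2,\alpha}$ that satisfy (1), (2), (3). *Problem $\mathcal B$*: the equations $$-y_j''(t)-2i(\operatorname{Im}b_j)\,y_j'(t)+|b_j|^2y_j(t)=0,\qquad 0<t<1,\quad\text{for every edge } e_j$$ (for $y_j\in W_2^2[0,1]$, almost everywhere), the conditions (1), (2), (3), and the Kirchhoff-type conditions $$y_j'(1)+\beta_jy_j(1)=\sum_{\nu\in V_j}\tilde p_\nu y_\nu'(0),\qquad \beta_j=b_j-\sum_{\nu\in V_j}\tilde p_\nu b_\nu,\qquad\text{for every internal vertex } v_j,$$ where the series is required to converge (unconditionally). **Theorem.** A tuple $y\in W^1_{2,\alpha}$ is a solution of problem $\mathcal V$ if and only if $y\in W^2_{2,\alpha}$ and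 $y$ is a solution of problem $\mathcal B$. -/

import Mathlib

open MeasureTheory Set

namespace TimeTree

/-- The derivative of a function on the interval `[0, 1]`, one-sided at the end points. -/
noncomputable def D (f : ℝ → ℂ) : ℝ → ℂ := derivWithin f (Icc 0 1)

/-- Membership in the Sobolev space `W_2^s[0, 1]` of complex-valued functions: for `s = 0` this is
`L_2(0, 1)`; for `s ≥ 1` the derivatives of order less than `s` exist everywhere on `[0, 1]`, the one
of order `s - 1` is absolutely continuous, and the one of order `s` is in `L_2(0, 1)`. Only the
values of `f` on `[0, 1]` matter. -/
def MemW : ℕ → (ℝ → ℂ) → Prop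
  | 0, f => MemLp f 2 (volume.restrict (Icc 0 1))
  | s + 1, f => (∀ k < s, DifferentiableOn ℝ (D^[k] f) (Icc 0 1)) ∧
      AbsolutelyContinuousOnInterval (D^[s] f) 0 1 ∧
      MemLp (D^[s + 1] f) 2 (volume.restrict (Icc 0 1))

/-- The square of the norm of `W_2^s[0, 1]`. -/
noncomputable def normSqW (s : ℕ) (f : ℝ → ℂ) : ℝ :=
  ∑ k ∈ Finset.range (s + 1), ∫ t in (0 : ℝ)..1, ‖D^[k] f t‖ ^ 2

/-- The edges of the infinite tree with `T` tiers. An edge of tier `k + 1` is the word of length `k`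
that lists, the most recent one first, the states (numbered by `ℕ`) taken by the process at the
times `1, …, k`. The empty word is the edge that leaves the root; the edge `l :: w` starts at
the end point of the edge `w`. The end point of an edge is an internal vertex if its tier is less
than `T`, and a boundary vertex if its tier is `T`. -/
abbrev Edge (T : ℕ) : Type := {w : List ℕ // w.length < T}

namespace Edge

variable {T : ℕ}

/-- The edge that leaves the root of the tree. -/
def root (hT : 0 < T) : Edge T := ⟨[], hT⟩

/-- The end point of the edge is an internal vertex. -/
def IsInternal (j : Edge T) : Prop := j.1.length + 1 < T

/-- The end point of the edge is a boundary vertex. -/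
def IsBoundary (j : Edge T) : Prop := j.1.length + 1 = T

/-- The edges that leave the internal vertex at the end of `j`, numbered by `l`. -/
def child (j : Edge T) (h : j.IsInternal) (l : ℕ) : Edge T := ⟨l :: j.1, h⟩

/-- The weight of an edge: the probability of the scenario that leads to it, i.e. the product of the
probabilities of the states on the way from the root. -/
noncomputable def weight (p : ℕ → ℝ) (j : Edge T) : ℝ := (j.1.map p).prod

/-- The coefficient on an edge: `b₁` on the first edge, and the value `θ l` of the most recent
state `l` on all others. -/
noncomputable def coeff (b₁ : ℂ) (θ : ℕ → ℂ) (j : Edge T) : ℂ :=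
  match j.1 with
  | [] => b₁
  | l :: _ => θ l

end Edge

variable {T : ℕ}

/-- Membership of a tuple in the weighted space `W^s_{2,α}`. -/
def MemWeightedW (p : ℕ → ℝ) (s : ℕ) (y : Edge T → ℝ → ℂ) : Prop :=
  (∀ j, MemW s (y j)) ∧ Summable fun j => j.weight p * normSqW s (y j)

/-- The differential expression `ℓ_j y = y_j' + b_j y_j`. -/
noncomputable def ell (b₁ : ℂ) (θ : ℕ → ℂ) (y : Edge T → ℝ → ℂ) (j : Edge T) (t : ℝ) : ℂ :=
  D (y j) t + j.coeff b₁ θ * y j t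

/-- The energy functional; for bounded `θ` the series converges on all of `W^1_{2,α}`. -/
noncomputable def energy (p : ℕ → ℝ) (b₁ : ℂ) (θ : ℕ → ℂ) (y : Edge T → ℝ → ℂ) : ℝ :=
  ∑' j, j.weight p * ∫ t in (0 : ℝ)..1, ‖ell b₁ θ y j t‖ ^ 2

/-- The initial condition at the root, the gluing conditions at the internal vertices and the
terminal conditions at the other boundary vertices. -/
structure Conditions (hT : 0 < T) (φ₀ φ₁ : ℂ) (y : Edge T → ℝ → ℂ) : Prop where
  initial : y (Edge.root hT) 0 = φ₀
  gluing : ∀ (j : Edge T) (h : j.IsInternal) (l : ℕ), y j 1 = y (j.child h l) 0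
  terminal : ∀ j : Edge T, j.IsBoundary → y j 1 = φ₁

/-- `y` is a solution of the variational problem: it minimises the energy over all tuples of
`W^1_{2,α}` that satisfy the conditions. -/
structure SolvesV (hT : 0 < T) (p : ℕ → ℝ) (b₁ : ℂ) (θ : ℕ → ℂ) (φ₀ φ₁ : ℂ)
    (y : Edge T → ℝ → ℂ) : Prop where
  mem : MemWeightedW p 1 y
  conditions : Conditions hT φ₀ φ₁ y
  minimal : ∀ z : Edge T → ℝ → ℂ, MemWeightedW p 1 z → Conditions hT φ₀ φ₁ z →
    energy p b₁ θ y ≤ energy p b₁ θ z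

/-- The number `β_j = b_j - ∑_l p_l θ_l` at the internal vertex at the end of `j`. -/
noncomputable def beta (p : ℕ → ℝ) (b₁ : ℂ) (θ : ℕ → ℂ) (j : Edge T) (h : j.IsInternal) : ℂ :=
  j.coeff b₁ θ - ∑' l, (p l : ℂ) * (j.child h l).coeff b₁ θ

/-- `y` satisfies the equations and the conditions of the boundary value problem; for `y` in
`W^2_{2,α}` the equations are equalities in `L_2(0, 1)`, i.e. they hold almost everywhere. -/
structure SolvesB (hT : 0 < T) (p : ℕ → ℝ) (b₁ : ℂ) (θ : ℕ → ℂ) (φ₀ φ₁ : ℂ)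
    (y : Edge T → ℝ → ℂ) : Prop where
  equation : ∀ j : Edge T, ∀ᵐ t ∂(volume.restrict (Ioo (0 : ℝ) 1)),
    -D (D (y j)) t - 2 * Complex.I * ((j.coeff b₁ θ).im : ℂ) * D (y j) t
      + ((‖j.coeff b₁ θ‖ ^ 2 : ℝ) : ℂ) * y j t = 0
  conditions : Conditions hT φ₀ φ₁ y
  kirchhoff : ∀ (j : Edge T) (h : j.IsInternal),
    HasSum (fun l : ℕ => (p l : ℂ) * D (y (j.child h l)) 0)
      (D (y j) 1 + beta p b₁ θ j h * y j 1)

end TimeTree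

/-!
The energy is the square of the norm of the tuple `g = y' + b y` in the weighted `L_2` space over
all edges (`totalSqNorm`), so it is a quadratic functional, and an admissible `y` is a minimiser if
and only if its first variation `∑ α_j ⟨g_j, z_j' + b_j z_j⟩` (`totalPairing`) vanishes for all
variations `z` in `W^1_{2,α}` with homogeneous conditions.

Let `y` be a minimiser (`solvesB_of_solvesV`). Variations supported on a single edge give, by a
lemma of du Bois-Reymond type (`exists_eq_exp_of_pairing_eq_zero`), that `g_j` is a multiple of
`exp (conj b_j t)`. So `g_j' = conj b_j g_j`, which is the second-order equation, and bounds `y_j''`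
by `y_j'` and `y_j` uniformly in `j`, whence `y ∈ W^2_{2,α}`. Integration by parts now reduces the
first variation to boundary terms (`pairing_ell`). For the variation `hat j`, which is one at the
end of the internal edge `j` and vanishes at all other vertices, they say that `g_j 1` is the
average of the values of `g` at the beginnings of the children of `j`; this is the Kirchhoff-type
condition (`hasSum_ell_iff`).

Conversely (`solvesV_of_solvesB`), if `y` solves the boundary value problem, then the first
variation in the direction `z` is the sum of the boundary terms on all edges. The trace inequality
(`norm_sq_le_of_memW`) makes their series converge absolutely, so the terms may be collected at the
vertices (`hasSum_child_iff`), where they cancel by the Kirchhoff-type condition.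
-/

namespace TimeTree

open ComplexConjugate

/-! ### Absolutely continuous complex-valued functions -/

theorem absolutelyContinuousOnInterval_of_dist_le {X Y : Type*} [PseudoMetricSpace X]
    [PseudoMetricSpace Y] {f : ℝ → X} {g : ℝ → Y} {a b : ℝ}
    (hf : AbsolutelyContinuousOnInterval f a b)
    (h : ∀ s ∈ uIcc a b, ∀ t ∈ uIcc a b, dist (g s) (g t) ≤ dist (f s) (f t)) :
    AbsolutelyContinuousOnInterval g a b := by
  rw [absolutelyContinuousOnInterval_iff] at hf ⊢
  intro ε hε
  obtain ⟨δ, hδ, H⟩ := hf ε hε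
  refine ⟨δ, hδ, fun E hE hlt => lt_of_le_of_lt (Finset.sum_le_sum fun i hi => ?_) (H E hE hlt)⟩
  exact h _ (hE.1 i hi).1 _ (hE.1 i hi).2

theorem absolutelyContinuousOnInterval_congr {f g : ℝ → ℂ}
    (hf : AbsolutelyContinuousOnInterval f 0 1) (h : EqOn g f (Icc 0 1)) :
    AbsolutelyContinuousOnInterval g 0 1 := by
  refine absolutelyContinuousOnInterval_of_dist_le hf fun s hs t ht => ?_
  rw [uIcc_of_le zero_le_one] at hs ht
  rw [h hs, h ht]

theorem absolutelyContinuousOnInterval_conj {f : ℝ → ℂ} {a b : ℝ}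
    (hf : AbsolutelyContinuousOnInterval f a b) :
    AbsolutelyContinuousOnInterval (fun t => conj (f t)) a b :=
  absolutelyContinuousOnInterval_of_dist_le hf fun _ _ _ _ => (Complex.dist_conj_conj _ _).le

theorem absolutelyContinuousOnInterval_mul {f g : ℝ → ℂ} {a b : ℝ}
    (hf : AbsolutelyContinuousOnInterval f a b) (hg : AbsolutelyContinuousOnInterval g a b) :
    AbsolutelyContinuousOnInterval (fun t => f t * g t) a b :=
  hf.smul hg

theorem absolutelyContinuousOnInterval_const_mul {f : ℝ → ℂ} {a b : ℝ} (c : ℂ)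
    (hf : AbsolutelyContinuousOnInterval f a b) :
    AbsolutelyContinuousOnInterval (fun t => c * f t) a b :=
  hf.const_smul c

theorem absolutelyContinuousOnInterval_re {f : ℝ → ℂ} {a b : ℝ}
    (hf : AbsolutelyContinuousOnInterval f a b) :
    AbsolutelyContinuousOnInterval (fun t => (f t).re) a b :=
  absolutelyContinuousOnInterval_of_dist_le hf fun s _ t _ => by
    rw [Real.dist_eq, Complex.dist_eq, ← Complex.sub_re]; exact Complex.abs_re_le_norm _

theorem absolutelyContinuousOnInterval_im {f : ℝ → ℂ} {a b : ℝ}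
    (hf : AbsolutelyContinuousOnInterval f a b) :
    AbsolutelyContinuousOnInterval (fun t => (f t).im) a b :=
  absolutelyContinuousOnInterval_of_dist_le hf fun s _ t _ => by
    rw [Real.dist_eq, Complex.dist_eq, ← Complex.sub_im]; exact Complex.abs_im_le_norm _

theorem absolutelyContinuousOnInterval_intervalIntegral {u : ℝ → ℂ}
    (hu : IntervalIntegrable u volume 0 1) :
    AbsolutelyContinuousOnInterval (fun x => ∫ t in (0 : ℝ)..x, u t) 0 1 := by
  have hre : IntervalIntegrable (fun t => (u t).re) volume 0 1 := ⟨hu.1.re, hu.2.re⟩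
  have him : IntervalIntegrable (fun t => (u t).im) volume 0 1 := ⟨hu.1.im, hu.2.im⟩
  have ofReal {f : ℝ → ℝ} (hf : AbsolutelyContinuousOnInterval f 0 1) :
      AbsolutelyContinuousOnInterval (fun t => (f t : ℂ)) 0 1 :=
    absolutelyContinuousOnInterval_of_dist_le hf fun s _ t _ => by
      rw [Complex.dist_eq, ← Complex.ofReal_sub, Complex.norm_real, Real.dist_eq, Real.norm_eq_abs]
  have h1 := ofReal (hre.absolutelyContinuousOnInterval_intervalIntegral (c := 0) (by simp))
  have h2 := ofReal (him.absolutelyContinuousOnInterval_intervalIntegral (c := 0) (by simp))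
  refine absolutelyContinuousOnInterval_congr
    (h1.fun_add (absolutelyContinuousOnInterval_const_mul Complex.I h2)) fun x hx => ?_
  have hux : IntervalIntegrable u volume 0 x :=
    hu.mono_set (by rw [uIcc_of_le hx.1, uIcc_of_le zero_le_one]; exact Icc_subset_Icc_right hx.2)
  have e1 := Complex.reCLM.intervalIntegral_comp_comm hux
  have e2 := Complex.imCLM.intervalIntegral_comp_comm hux
  simp only [Complex.reCLM_apply, Complex.imCLM_apply] at e1 e2
  simp only [e1, e2]
  rw [mul_comm, Complex.re_add_im]

/-- Lebesgue measure on the closed unit interval. -/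
noncomputable abbrev leb : Measure ℝ := volume.restrict (Icc 0 1)

theorem integral_zero_one {F : Type*} [NormedAddCommGroup F] [NormedSpace ℝ F] (f : ℝ → F) :
    ∫ t in (0 : ℝ)..1, f t = ∫ t, f t ∂leb := by
  rw [intervalIntegral.integral_of_le zero_le_one, integral_Icc_eq_integral_Ioc]

theorem integral_leb_const (c : ℝ) : ∫ _, c ∂leb = c := by simp

theorem ae_leb_mem : ∀ᵐ t ∂leb, t ∈ Ioo (0 : ℝ) 1 := by
  rw [leb, ← restrict_Ioo_eq_restrict_Icc]
  exact ae_restrict_mem measurableSet_Ioo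

theorem ae_hasDerivAt_D {f : ℝ → ℂ} (hf : AbsolutelyContinuousOnInterval f 0 1) :
    ∀ᵐ t ∂leb, HasDerivAt f (D f t) t := by
  filter_upwards [ae_restrict_of_ae hf.boundedVariationOn.ae_differentiableAt_of_mem_uIcc,
    ae_leb_mem] with t ht ht'
  have : DifferentiableAt ℝ f t := ht (by rw [uIcc_of_le zero_le_one]; exact Ioo_subset_Icc_self ht')
  rw [D, derivWithin_of_mem_nhds (Icc_mem_nhds ht'.1 ht'.2)]
  exact this.hasDerivAt

/-- At interior points `D` is the ordinary derivative. -/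
theorem D_ae_eq {f f' : ℝ → ℂ} (h : ∀ᵐ t ∂leb, HasDerivAt f (f' t) t) :
    ∀ᵐ t ∂leb, D f t = f' t := by
  filter_upwards [h, ae_leb_mem] with t ht ht'
  rw [D, derivWithin_of_mem_nhds (Icc_mem_nhds ht'.1 ht'.2), ht.deriv]

theorem intervalIntegrable_iff_leb {u : ℝ → ℂ} :
    IntervalIntegrable u volume 0 1 ↔ Integrable u leb :=
  intervalIntegrable_iff_integrableOn_Icc_of_le zero_le_one

theorem integrable_D {f : ℝ → ℂ} (hf : AbsolutelyContinuousOnInterval f 0 1) :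
    Integrable (D f) leb := by
  have hre := (intervalIntegrable_iff_integrableOn_Icc_of_le zero_le_one).1
    (absolutelyContinuousOnInterval_re hf).intervalIntegrable_deriv
  have him := (intervalIntegrable_iff_integrableOn_Icc_of_le zero_le_one).1
    (absolutelyContinuousOnInterval_im hf).intervalIntegrable_deriv
  have h := (hre.ofReal (𝕜 := ℂ)).add ((him.ofReal (𝕜 := ℂ)).const_mul Complex.I)
  refine h.congr ?_
  filter_upwards [ae_hasDerivAt_D hf] with t ht
  have e1 : deriv (fun t => (f t).re) t = (D f t).re :=
    (Complex.reCLM.hasFDerivAt.comp_hasDerivAt t ht).deriv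
  have e2 : deriv (fun t => (f t).im) t = (D f t).im :=
    (Complex.imCLM.hasFDerivAt.comp_hasDerivAt t ht).deriv
  simp only [Pi.add_apply, e1, e2]
  rw [mul_comm]
  exact Complex.re_add_im _

/-- The fundamental theorem of calculus for absolutely continuous complex-valued functions. -/
theorem eq_add_integral_D {f : ℝ → ℂ} (hf : AbsolutelyContinuousOnInterval f 0 1) {x : ℝ}
    (hx : x ∈ Icc (0 : ℝ) 1) : f x = f 0 + ∫ t in (0 : ℝ)..x, D f t := by
  have hi := intervalIntegrable_iff_leb.2 (integrable_D hf)
  have hac := hf.fun_sub (absolutelyContinuousOnInterval_intervalIntegral hi)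
  have hd : ∀ᵐ t, t ∈ uIcc (0 : ℝ) 1 →
      HasDerivAt (fun x => f x - ∫ t in (0 : ℝ)..x, D f t) 0 t := by
    have h1 := (ae_restrict_iff' measurableSet_Icc).1 (ae_hasDerivAt_D hf)
    filter_upwards [h1, hi.ae_hasDerivAt_integral] with t h1 h2 ht
    have := (h1 (by rwa [uIcc_of_le zero_le_one] at ht)).sub (h2 ht 0 (by simp))
    rwa [sub_self] at this
  obtain ⟨C, hC⟩ := hac.const_of_ae_hasDerivAt_zero hd
  rw [uIcc_of_le zero_le_one] at hC
  have h0 := hC 0 (by simp)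
  have hx' := hC x hx
  simp only [intervalIntegral.integral_same, sub_zero] at h0
  rw [h0, ← hx']; ring

theorem integral_D {f : ℝ → ℂ} (hf : AbsolutelyContinuousOnInterval f 0 1) :
    ∫ t, D f t ∂leb = f 1 - f 0 := by
  rw [← integral_zero_one, eq_add_integral_D hf (x := 1) (by simp)]; ring

theorem memLp_of_continuousOn {f : ℝ → ℂ} (hf : ContinuousOn f (Icc 0 1)) : MemLp f 2 leb := by
  obtain ⟨C, hC⟩ := isCompact_Icc.exists_bound_of_continuousOn hf
  exact MemLp.of_bound (hf.aestronglyMeasurable measurableSet_Icc) C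
    ((ae_restrict_mem measurableSet_Icc).mono fun t ht => hC t ht)

theorem absolutelyContinuousOnInterval_of_contDiff {f : ℝ → ℂ} (hf : ContDiff ℝ 1 f) :
    AbsolutelyContinuousOnInterval f 0 1 :=
  hf.contDiffOn.absolutelyContinuousOnInterval

theorem continuousOn_of_absolutelyContinuous {f : ℝ → ℂ}
    (hf : AbsolutelyContinuousOnInterval f 0 1) : ContinuousOn f (Icc 0 1) := by
  simpa [uIcc_of_le (zero_le_one (α := ℝ))] using hf.continuousOn

/-! ### The squared norm and the inner product of `L_2(0, 1)` -/

/-- The square of the norm of `L_2(0, 1)`. -/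
noncomputable def sqNorm (u : ℝ → ℂ) : ℝ := ∫ t in (0 : ℝ)..1, ‖u t‖ ^ 2

/-- The inner product of `L_2(0, 1)`, linear in the first argument. -/
noncomputable def pairing (u v : ℝ → ℂ) : ℂ := ∫ t in (0 : ℝ)..1, u t * conj (v t)

theorem sqNorm_eq (u : ℝ → ℂ) : sqNorm u = ∫ t, ‖u t‖ ^ 2 ∂leb := integral_zero_one _

theorem pairing_eq (u v : ℝ → ℂ) : pairing u v = ∫ t, u t * conj (v t) ∂leb := integral_zero_one _

theorem sqNorm_nonneg (u : ℝ → ℂ) : 0 ≤ sqNorm u := by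
  rw [sqNorm_eq]; exact integral_nonneg fun t => by positivity

theorem sqNorm_congr {u v : ℝ → ℂ} (h : ∀ᵐ t ∂leb, u t = v t) : sqNorm u = sqNorm v := by
  rw [sqNorm_eq, sqNorm_eq]; exact integral_congr_ae (h.mono fun t ht => by simp only [ht])

theorem integrable_sq {u : ℝ → ℂ} (hu : MemLp u 2 leb) : Integrable (fun t => ‖u t‖ ^ 2) leb :=
  hu.integrable_norm_pow (by norm_num)

theorem memLp_conj {u : ℝ → ℂ} (hu : MemLp u 2 leb) : MemLp (fun t => conj (u t)) 2 leb :=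
  hu.of_le (Complex.continuous_conj.comp_aestronglyMeasurable hu.1)
    (Filter.Eventually.of_forall fun t => by simp)

theorem integrable_mul_conj {u v : ℝ → ℂ} (hu : MemLp u 2 leb) (hv : MemLp v 2 leb) :
    Integrable (fun t => u t * conj (v t)) leb :=
  hu.integrable_mul (memLp_conj hv)

theorem sqNorm_add {u v : ℝ → ℂ} (hu : MemLp u 2 leb) (hv : MemLp v 2 leb) :
    sqNorm (fun t => u t + v t) = sqNorm u + 2 * (pairing u v).re + sqNorm v := by
  have hre : (pairing u v).re = ∫ t, (u t * conj (v t)).re ∂leb := by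
    rw [pairing_eq]; exact (integral_re (integrable_mul_conj hu hv)).symm
  have hI : Integrable (fun t => (u t * conj (v t)).re) leb := (integrable_mul_conj hu hv).re
  have hA : Integrable (fun t => ‖u t‖ ^ 2 + 2 * (u t * conj (v t)).re) leb :=
    (integrable_sq hu).add (hI.const_mul 2)
  rw [hre, sqNorm_eq, sqNorm_eq, sqNorm_eq, ← integral_const_mul,
    ← integral_add (integrable_sq hu) (hI.const_mul 2), ← integral_add hA (integrable_sq hv)]
  refine integral_congr_ae (Filter.Eventually.of_forall fun t => ?_)
  simp only [← Complex.normSq_eq_norm_sq, Complex.normSq_add]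
  ring

theorem sqNorm_const_mul (c : ℂ) (u : ℝ → ℂ) :
    sqNorm (fun t => c * u t) = ‖c‖ ^ 2 * sqNorm u := by
  rw [sqNorm_eq, sqNorm_eq, ← integral_const_mul]
  simp only [norm_mul, mul_pow]

theorem pairing_const_mul_right (c : ℂ) (u v : ℝ → ℂ) :
    pairing u (fun t => c * v t) = conj c * pairing u v := by
  rw [pairing_eq, pairing_eq, ← integral_const_mul]
  refine integral_congr_ae (Filter.Eventually.of_forall fun t => ?_)
  simp only [map_mul]; ring

theorem norm_pairing_le {u v : ℝ → ℂ} (hu : MemLp u 2 leb) (hv : MemLp v 2 leb) :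
    ‖pairing u v‖ ≤ sqNorm u + sqNorm v := by
  rw [pairing_eq, sqNorm_eq, sqNorm_eq, ← integral_add (integrable_sq hu) (integrable_sq hv)]
  refine norm_integral_le_of_norm_le ((integrable_sq hu).add (integrable_sq hv))
    (Filter.Eventually.of_forall fun t => ?_)
  rw [norm_mul, RCLike.norm_conj]
  nlinarith [sq_nonneg (‖u t‖ - ‖v t‖), sq_nonneg ‖u t‖, sq_nonneg ‖v t‖]

theorem sqNorm_add_le {u v : ℝ → ℂ} (hu : MemLp u 2 leb) (hv : MemLp v 2 leb) :
    sqNorm (fun t => u t + v t) ≤ 3 * (sqNorm u + sqNorm v) := by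
  have := norm_pairing_le hu hv
  have := (Complex.re_le_norm (pairing u v))
  rw [sqNorm_add hu hv]; linarith

/-- The trace inequality of `W_2^1[0, 1]`, with a constant that does not depend on the point. -/
theorem norm_sq_le_of_memW {f : ℝ → ℂ} (hf : MemW 1 f) {a : ℝ} (ha : a ∈ Icc (0 : ℝ) 1) :
    ‖f a‖ ^ 2 ≤ 2 * (sqNorm f + sqNorm (D f)) := by
  obtain ⟨-, hac, hL⟩ := hf
  change AbsolutelyContinuousOnInterval f 0 1 at hac
  change MemLp (D f) 2 leb at hL
  have hfc := continuousOn_of_absolutelyContinuous hac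
  have hDi := integrable_D hac
  set S := ∫ t, ‖D f t‖ ∂leb with hS
  have hSsq : S ^ 2 ≤ sqNorm (D f) := by
    -- Cauchy–Schwarz, as nonnegativity of the variance
    have h1 : 0 ≤ ∫ t, (‖D f t‖ - S) ^ 2 ∂leb := integral_nonneg fun t => sq_nonneg _
    have h2 : ∫ t, (‖D f t‖ - S) ^ 2 ∂leb = sqNorm (D f) - 2 * S * S + S ^ 2 := by
      have hA : Integrable (fun t => ‖D f t‖ ^ 2 - 2 * S * ‖D f t‖) leb :=
        (integrable_sq hL).sub (hDi.norm.const_mul _)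
      conv_rhs => rw [← integral_leb_const (S ^ 2)]
      nth_rewrite 3 [hS]
      rw [sqNorm_eq, ← integral_const_mul, ← integral_sub (integrable_sq hL) (hDi.norm.const_mul _),
        ← integral_add hA (integrable_const _)]
      refine integral_congr_ae (Filter.Eventually.of_forall fun t => ?_)
      simp only; ring
    nlinarith
  have hpt : ∀ t ∈ Icc (0 : ℝ) 1, ‖f a‖ ^ 2 ≤ 2 * ‖f t‖ ^ 2 + 2 * S ^ 2 := by
    intro t ht
    have hsub : uIcc t a ⊆ uIcc (0 : ℝ) 1 := by
      rw [uIcc_of_le (zero_le_one (α := ℝ))]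
      exact uIcc_subset_Icc ht ha
    have h1 : f a - f t = ∫ s in t..a, D f s := by
      rw [eq_add_integral_D hac ha, eq_add_integral_D hac ht, add_sub_add_left_eq_sub]
      have hi := intervalIntegrable_iff_leb.2 hDi
      exact intervalIntegral.integral_interval_sub_left
        (hi.mono_set (by rw [uIcc_of_le ha.1, uIcc_of_le zero_le_one]
                         exact Icc_subset_Icc_right ha.2))
        (hi.mono_set (by rw [uIcc_of_le ht.1, uIcc_of_le zero_le_one]
                         exact Icc_subset_Icc_right ht.2))
    have h2 : ‖f a - f t‖ ≤ S := by
      rw [h1]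
      refine intervalIntegral.norm_integral_le_integral_norm_uIoc.trans ?_
      refine setIntegral_mono_set (t := Icc 0 1) hDi.norm
        (Filter.Eventually.of_forall fun t => norm_nonneg _)
        (Filter.Eventually.of_forall (uIoc_subset_uIcc.trans (uIcc_subset_Icc ht ha)))
    have h3 : ‖f a‖ ≤ ‖f t‖ + S := by
      have := norm_add_le (f t) (f a - f t)
      rw [add_sub_cancel] at this
      linarith
    nlinarith [norm_nonneg (f a), norm_nonneg (f t), sq_nonneg (‖f t‖ - S)]
  have hint : ∫ _, ‖f a‖ ^ 2 ∂leb ≤ ∫ t, (2 * ‖f t‖ ^ 2 + 2 * S ^ 2) ∂leb := by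
    refine integral_mono_ae (integrable_const _)
      (((integrable_sq (memLp_of_continuousOn hfc)).const_mul 2).add (integrable_const _)) ?_
    filter_upwards [ae_restrict_mem measurableSet_Icc] with t ht using hpt t ht
  rw [integral_add ((integrable_sq (memLp_of_continuousOn hfc)).const_mul 2) (integrable_const _),
    integral_const_mul, integral_leb_const, integral_leb_const, ← sqNorm_eq] at hint
  linarith

/-- If `g' = conj b * g`, then integration by parts reduces the inner product of `g` with `h' + b h`
to the boundary values. -/
theorem pairing_deriv_add {g h : ℝ → ℂ} {b : ℂ} (hg : AbsolutelyContinuousOnInterval g 0 1)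
    (hh : AbsolutelyContinuousOnInterval h 0 1) (hD : ∀ᵐ t ∂leb, D g t = conj b * g t) :
    pairing g (fun t => D h t + b * h t) = g 1 * conj (h 1) - g 0 * conj (h 0) := by
  rw [← integral_D (absolutelyContinuousOnInterval_mul hg (absolutelyContinuousOnInterval_conj hh)),
    pairing_eq]
  refine integral_congr_ae ?_
  have hd : ∀ᵐ t ∂leb, HasDerivAt (fun t => g t * conj (h t))
      (D g t * conj (h t) + g t * conj (D h t)) t := by
    filter_upwards [ae_hasDerivAt_D hg, ae_hasDerivAt_D hh] with t h1 h2
    exact h1.mul (Complex.conjCLE.toContinuousLinearMap.hasFDerivAt.comp_hasDerivAt t h2)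
  filter_upwards [D_ae_eq hd, hD] with t h1 h2
  rw [h1, h2]
  simp only [map_add, map_mul]
  ring

/-! ### Sobolev functions on one edge -/

theorem memW_one_iff {f : ℝ → ℂ} :
    MemW 1 f ↔ AbsolutelyContinuousOnInterval f 0 1 ∧ MemLp (D f) 2 leb :=
  ⟨fun h => h.2, fun h => ⟨fun _ hk => absurd hk (Nat.not_lt_zero _), h⟩⟩

theorem memW_two_iff {f : ℝ → ℂ} :
    MemW 2 f ↔ DifferentiableOn ℝ f (Icc 0 1) ∧ AbsolutelyContinuousOnInterval (D f) 0 1 ∧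
      MemLp (D (D f)) 2 leb := by
  refine ⟨fun h => ⟨h.1 0 one_pos, h.2⟩, fun h => ⟨fun k hk => ?_, h.2⟩⟩
  obtain rfl : k = 0 := Nat.lt_one_iff.1 hk
  exact h.1

theorem normSqW_one (f : ℝ → ℂ) : normSqW 1 f = sqNorm f + sqNorm (D f) := by
  simp [normSqW, sqNorm, Finset.sum_range_succ]

theorem normSqW_two (f : ℝ → ℂ) :
    normSqW 2 f = sqNorm f + sqNorm (D f) + sqNorm (D (D f)) := by
  simp [normSqW, sqNorm, Finset.sum_range_succ]

theorem memLp_of_memW {f : ℝ → ℂ} (hf : MemW 1 f) : MemLp f 2 leb :=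
  memLp_of_continuousOn (continuousOn_of_absolutelyContinuous (memW_one_iff.1 hf).1)

theorem D_add_const_mul {f g : ℝ → ℂ} (hf : MemW 1 f) (hg : MemW 1 g) (c : ℂ) :
    ∀ᵐ t ∂leb, D (fun t => f t + c * g t) t = D f t + c * D g t := by
  refine D_ae_eq ?_
  filter_upwards [ae_hasDerivAt_D (memW_one_iff.1 hf).1,
    ae_hasDerivAt_D (memW_one_iff.1 hg).1] with t h1 h2
  exact h1.add (h2.const_mul c)

theorem memW_add_const_mul {f g : ℝ → ℂ} (hf : MemW 1 f) (hg : MemW 1 g) (c : ℂ) :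
    MemW 1 (fun t => f t + c * g t) := by
  have hf' := memW_one_iff.1 hf
  have hg' := memW_one_iff.1 hg
  refine memW_one_iff.2 ⟨hf'.1.fun_add (absolutelyContinuousOnInterval_const_mul c hg'.1), ?_⟩
  exact (hf'.2.add (hg'.2.const_mul c)).ae_eq
    ((D_add_const_mul hf hg c).mono fun t ht => ht.symm)

theorem memW_of_contDiff {f : ℝ → ℂ} (hf : ContDiff ℝ 1 f) : MemW 1 f := by
  refine memW_one_iff.2 ⟨absolutelyContinuousOnInterval_of_contDiff hf, ?_⟩
  refine (memLp_of_continuousOn (hf.continuous_deriv le_rfl).continuousOn).ae_eq ?_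
  refine (D_ae_eq (Filter.Eventually.of_forall fun t => ?_)).mono fun t ht => ht.symm
  exact (hf.differentiable one_ne_zero t).hasDerivAt

theorem hasDerivAt_exp_ofReal (c : ℂ) (t : ℝ) :
    HasDerivAt (fun t : ℝ => Complex.exp (c * t)) (c * Complex.exp (c * t)) t := by
  have := ((hasDerivAt_id t).ofReal_comp.const_mul c).cexp
  simpa [mul_comm] using this

theorem contDiff_exp_ofReal (c : ℂ) : ContDiff ℝ 1 (fun t : ℝ => Complex.exp (c * t)) :=
  (contDiff_const.mul Complex.ofRealCLM.contDiff).cexp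

theorem memLp_continuous_mul {f u : ℝ → ℂ} (hf : Continuous f) (hu : MemLp u 2 leb) :
    MemLp (fun t => f t * u t) 2 leb := by
  obtain ⟨C, hC⟩ := isCompact_Icc.exists_bound_of_continuousOn (hf.continuousOn (s := Icc 0 1))
  refine hu.of_le_mul (c := C) (hf.aestronglyMeasurable.mul hu.1) ?_
  filter_upwards [ae_restrict_mem measurableSet_Icc] with t ht
  rw [norm_mul]
  exact mul_le_mul_of_nonneg_right (hC t ht) (norm_nonneg _)

/-! ### Regularity of weak solutions on one edge -/

/-- The lemma of du Bois-Reymond for `h ↦ h' + b h`: a function orthogonal to all `h' + b h` with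
`h` vanishing at both end points is a multiple of `exp (conj b t)`. -/
theorem exists_eq_exp_of_pairing_eq_zero {g : ℝ → ℂ} {b : ℂ} (hg : MemLp g 2 leb)
    (H : ∀ h : ℝ → ℂ, MemW 1 h → h 0 = 0 → h 1 = 0 → pairing g (fun t => D h t + b * h t) = 0) :
    ∃ c : ℂ, ∀ᵐ t ∂leb, g t = c * Complex.exp (conj b * t) := by
  -- With `h = exp (-b t) k` the form `h' + b h` is `exp (-b t) k'`. The primitive `k` of `G - c`,
  -- where `G = exp (-conj b t) g` has mean `c`, turns the hypothesis into `‖G - c‖ = 0`.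
  set G : ℝ → ℂ := fun t => Complex.exp (-conj b * t) * g t with hG
  have hGL : MemLp G 2 leb := memLp_continuous_mul (contDiff_exp_ofReal _).continuous hg
  set c : ℂ := ∫ t, G t ∂leb with hc
  set u : ℝ → ℂ := fun t => G t - c with hu
  have huL : MemLp u 2 leb := hGL.sub (memLp_const c)
  have hGi : Integrable G leb := hGL.integrable (by norm_num)
  have hui : Integrable u leb := huL.integrable (by norm_num)
  have hu0 : ∫ t, u t ∂leb = 0 := by
    rw [hu, integral_sub hGi (integrable_const c), ← hc]
    simp
  have hui' := intervalIntegrable_iff_leb.2 hui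
  set k : ℝ → ℂ := fun x => ∫ t in (0 : ℝ)..x, u t with hk
  have hkac : AbsolutelyContinuousOnInterval k 0 1 :=
    absolutelyContinuousOnInterval_intervalIntegral hui'
  have hkd : ∀ᵐ t ∂leb, HasDerivAt k (u t) t := by
    rw [ae_restrict_iff' measurableSet_Icc]
    filter_upwards [hui'.ae_hasDerivAt_integral] with t ht ht'
    exact ht (by rwa [uIcc_of_le zero_le_one]) 0 (by simp)
  set h : ℝ → ℂ := fun t => Complex.exp (-b * t) * k t with hh
  have hhac : AbsolutelyContinuousOnInterval h 0 1 := absolutelyContinuousOnInterval_mul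
    (absolutelyContinuousOnInterval_of_contDiff (contDiff_exp_ofReal _)) hkac
  have hDh : ∀ᵐ t ∂leb, D h t = Complex.exp (-b * t) * u t - b * h t := by
    refine D_ae_eq ?_
    filter_upwards [hkd] with t ht
    have hprod : HasDerivAt h _ t := (hasDerivAt_exp_ofReal (-b) t).mul ht
    convert hprod using 1
    change _ - b * (Complex.exp (-b * t) * k t) = _
    ring
  have hhL : MemLp h 2 leb :=
    memLp_of_continuousOn (continuousOn_of_absolutelyContinuous hhac)
  have hDhL : MemLp (D h) 2 leb :=
    ((memLp_continuous_mul (contDiff_exp_ofReal (-b)).continuous huL).sub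
      (hhL.const_mul b)).ae_eq (hDh.mono fun t ht => ht.symm)
  have h0 := H h (memW_one_iff.2 ⟨hhac, hDhL⟩) (by simp [hh, hk])
    (by simp only [hh, hk]; rw [integral_zero_one, hu0, mul_zero])
  have hGu : ∫ t, G t * conj (u t) ∂leb = 0 := by
    rw [← h0, pairing_eq]
    refine integral_congr_ae (hDh.mono fun t ht => ?_)
    simp only [ht, hG, sub_add_cancel, map_mul, ← Complex.exp_conj, map_neg, Complex.conj_ofReal]
    ring
  have huu : sqNorm u = 0 := by
    have e : ((∫ t, ‖u t‖ ^ 2 ∂leb : ℝ) : ℂ) = 0 := by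
      rw [← integral_complex_ofReal]
      have e2 : ∀ t, ((‖u t‖ ^ 2 : ℝ) : ℂ) = G t * conj (u t) - c * conj (u t) := by
        intro t
        rw [← sub_mul, Complex.mul_conj, Complex.normSq_eq_norm_sq]
      simp only [e2]
      rw [integral_sub (integrable_mul_conj hGL huL)
        ((memLp_conj huL).integrable (by norm_num) |>.const_mul c), hGu, integral_const_mul,
        integral_conj, hu0]
      simp
    rw [sqNorm_eq]; exact_mod_cast e
  rw [sqNorm_eq, integral_eq_zero_iff_of_nonneg (fun t => by positivity) (integrable_sq huL)] at huu
  refine ⟨c, huu.mono fun t ht => ?_⟩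
  have ht' : G t = c := by
    have : ‖u t‖ ^ 2 = 0 := ht
    simpa [hu, sub_eq_zero] using this
  rw [← ht']
  change g t = Complex.exp (-conj b * t) * g t * Complex.exp (conj b * t)
  rw [mul_right_comm, ← Complex.exp_add]
  simp

/-- An absolutely continuous function whose derivative agrees almost everywhere with a continuous
function is continuously differentiable. -/
theorem hasDerivWithinAt_of_ae_eq {f w : ℝ → ℂ} (hf : AbsolutelyContinuousOnInterval f 0 1)
    (hw : ContinuousOn w (Icc 0 1)) (h : ∀ᵐ t ∂leb, D f t = w t) {x : ℝ}
    (hx : x ∈ Icc (0 : ℝ) 1) : HasDerivWithinAt f (w x) (Icc 0 1) x := by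
  set W : ℝ → ℂ := IccExtend zero_le_one (domRestrict (Icc 0 1) w) with hW
  have hWc : Continuous W := (continuousOn_iff_continuous_domRestrict.1 hw).Icc_extend'
  have hWw : ∀ t ∈ Icc (0 : ℝ) 1, W t = w t := fun t ht => by
    rw [hW, IccExtend_of_mem _ _ ht]; rfl
  have hEq : ∀ t ∈ Icc (0 : ℝ) 1, f t = f 0 + ∫ s in (0 : ℝ)..t, W s := by
    intro t ht
    rw [eq_add_integral_D hf ht]
    congr 1
    refine intervalIntegral.integral_congr_ae ?_
    filter_upwards [(ae_restrict_iff' measurableSet_Icc).1 h] with s hs hs'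
    rw [uIoc_of_le ht.1] at hs'
    have hs1 : s ∈ Icc (0 : ℝ) 1 := ⟨hs'.1.le, hs'.2.trans ht.2⟩
    rw [hs hs1, hWw s hs1]
  have hd := (hWc.integral_hasStrictDerivAt 0 x).hasDerivAt.const_add (f 0)
  rw [hWw x hx] at hd
  exact hd.hasDerivWithinAt.congr hEq (hEq x hx)

/-- If `f' + b f` is almost everywhere a multiple of `exp (conj b t)`, then `f` is in `W_2^2[0, 1]`
and satisfies the second-order equation at every point. -/
theorem regular_of_ae_eq_exp {f : ℝ → ℂ} {b c : ℂ} (hf : MemW 1 f)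
    (h : ∀ᵐ t ∂leb, D f t + b * f t = c * Complex.exp (conj b * t)) :
    MemW 2 f ∧ ∀ t ∈ Icc (0 : ℝ) 1, D (D f) t = (conj b - b) * D f t + (conj b * b) * f t := by
  obtain ⟨hac, -⟩ := memW_one_iff.1 hf
  have hfc := continuousOn_of_absolutelyContinuous hac
  set w : ℝ → ℂ := fun t => c * Complex.exp (conj b * t) - b * f t with hw
  have hwc : ContinuousOn w (Icc 0 1) :=
    (continuousOn_const.mul (contDiff_exp_ofReal _).continuous.continuousOn).sub
      (continuousOn_const.mul hfc)
  have hd : ∀ t ∈ Icc (0 : ℝ) 1, HasDerivWithinAt f (w t) (Icc 0 1) t := fun t ht =>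
    hasDerivWithinAt_of_ae_eq hac hwc (h.mono fun s hs => by simp only [hw]; rw [← hs]; ring) ht
  have hu : ∀ t ∈ Icc (0 : ℝ) 1, UniqueDiffWithinAt ℝ (Icc (0 : ℝ) 1) t :=
    uniqueDiffOn_Icc zero_lt_one
  have hD : EqOn (D f) w (Icc 0 1) := fun t ht => (hd t ht).derivWithin (hu t ht)
  have hDD : ∀ t ∈ Icc (0 : ℝ) 1, D (D f) t = (conj b - b) * D f t + (conj b * b) * f t := by
    intro t ht
    have h1 : HasDerivWithinAt w (c * (conj b * Complex.exp (conj b * t)) - b * w t)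
        (Icc 0 1) t :=
      ((hasDerivAt_exp_ofReal (conj b) t).hasDerivWithinAt.const_mul c).sub ((hd t ht).const_mul b)
    have h2 : D (D f) t = _ := (h1.congr hD (hD ht)).derivWithin (hu t ht)
    rw [h2, hD ht]
    simp only [hw]; ring
  have hDc : ContinuousOn (D f) (Icc 0 1) := hwc.congr hD
  refine ⟨memW_two_iff.2 ⟨fun t ht => (hd t ht).differentiableWithinAt,
    absolutelyContinuousOnInterval_congr ?_ hD, memLp_of_continuousOn ?_⟩, hDD⟩
  · exact (absolutelyContinuousOnInterval_const_mul c
      (absolutelyContinuousOnInterval_of_contDiff (contDiff_exp_ofReal _))).fun_sub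
        (absolutelyContinuousOnInterval_const_mul b hac)
  · exact ((continuousOn_const.mul hDc).add (continuousOn_const.mul hfc)).congr hDD

/-- A function of `W_2^2[0, 1]` is continuously differentiable, so it is in `W_2^1[0, 1]` together
with its derivative. -/
theorem memW_one_of_memW_two {f : ℝ → ℂ} (hf : MemW 2 f) : MemW 1 f ∧ MemW 1 (D f) := by
  obtain ⟨h1, h2, h3⟩ := memW_two_iff.1 hf
  refine ⟨memW_one_iff.2 ⟨?_, ?_⟩, memW_one_iff.2 ⟨h2, h3⟩⟩
  · have hDc := continuousOn_of_absolutelyContinuous h2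
    refine ContDiffOn.absolutelyContinuousOnInterval ?_
    rw [uIcc_of_le zero_le_one, show (1 : WithTop ℕ∞) = 0 + 1 from rfl,
      contDiffOn_succ_iff_derivWithin (uniqueDiffOn_Icc zero_lt_one)]
    exact ⟨h1, by simp, contDiffOn_zero.2 hDc⟩
  · exact memLp_of_continuousOn (continuousOn_of_absolutelyContinuous h2)

/-- For a solution of the second-order equation, `g = f' + b f` satisfies `g' = conj b * g`. -/
theorem D_ell_of_equation {f : ℝ → ℂ} {b : ℂ} (hf : MemW 2 f)
    (h : ∀ᵐ t ∂(volume.restrict (Ioo (0 : ℝ) 1)), -D (D f) t - 2 * Complex.I * (b.im : ℂ) * D f t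
      + ((‖b‖ ^ 2 : ℝ) : ℂ) * f t = 0) :
    ∀ᵐ t ∂leb, D (fun t => D f t + b * f t) t = conj b * (D f t + b * f t) := by
  obtain ⟨h1, h2⟩ := memW_one_of_memW_two hf
  rw [restrict_Ioo_eq_restrict_Icc] at h
  filter_upwards [h, D_add_const_mul h2 h1 b] with t ht hD
  have e1 : ((‖b‖ ^ 2 : ℝ) : ℂ) = conj b * b := by
    rw [mul_comm, Complex.mul_conj, Complex.normSq_eq_norm_sq]
  have e2 : 2 * Complex.I * (b.im : ℂ) = b - conj b := by
    rw [Complex.sub_conj]; push_cast; ring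
  rw [e1, e2] at ht
  rw [hD]
  linear_combination -ht

variable {T : ℕ} {p : ℕ → ℝ} {b₁ : ℂ} {θ : ℕ → ℂ}

/-! ### Weighted square-summable families on the tree -/

theorem Edge.weight_pos (hp : ∀ l, 0 < p l) (j : Edge T) : 0 < j.weight p :=
  List.prod_pos fun a ha => by
    obtain ⟨l, -, rfl⟩ := List.mem_map.1 ha
    exact hp l

theorem Edge.weight_nonneg (hp : ∀ l, 0 < p l) (j : Edge T) : 0 ≤ j.weight p :=
  (j.weight_pos hp).le

theorem Edge.weight_child (j : Edge T) (h : j.IsInternal) (l : ℕ) :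
    (j.child h l).weight p = p l * j.weight p := by
  simp [Edge.weight, Edge.child]

theorem Edge.exists_norm_coeff_le (b₁ : ℂ) (hθ : BddAbove (Set.range fun l => ‖θ l‖)) :
    ∃ M, ∀ j : Edge T, ‖j.coeff b₁ θ‖ ≤ M := by
  obtain ⟨M, hM⟩ := hθ
  refine ⟨max ‖b₁‖ M, fun j => ?_⟩
  rcases j with ⟨_ | ⟨l, w⟩, hw⟩
  · exact le_max_left _ _
  · exact (hM ⟨l, rfl⟩).trans (le_max_right _ _)

/-- Membership of a family of functions on `[0, 1]`, one for each edge, in the `L_2` space over all edges with the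
weights of the tree. -/
structure SqSummable (p : ℕ → ℝ) (u : Edge T → ℝ → ℂ) : Prop where
  memLp : ∀ j, MemLp (u j) 2 leb
  summable : Summable fun j => j.weight p * sqNorm (u j)

namespace SqSummable

variable {u v : Edge T → ℝ → ℂ}

theorem congr (hu : SqSummable p u) (h : ∀ j, ∀ᵐ t ∂leb, u j t = v j t) : SqSummable p v :=
  ⟨fun j => (hu.memLp j).ae_eq (h j), hu.summable.congr fun j => by rw [sqNorm_congr (h j)]⟩

theorem add (hp : ∀ l, 0 < p l) (hu : SqSummable p u) (hv : SqSummable p v) :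
    SqSummable p (fun j t => u j t + v j t) := by
  refine ⟨fun j => (hu.memLp j).add (hv.memLp j), ?_⟩
  refine Summable.of_nonneg_of_le (fun j => mul_nonneg (j.weight_nonneg hp) (sqNorm_nonneg _))
    (fun j => ?_) ((hu.summable.add hv.summable).mul_left 3)
  have := mul_le_mul_of_nonneg_left (sqNorm_add_le (hu.memLp j) (hv.memLp j)) (j.weight_nonneg hp)
  linarith

theorem coeff_mul (hp : ∀ l, 0 < p l) {c : Edge T → ℂ} {M : ℝ} (hc : ∀ j, ‖c j‖ ≤ M)
    (hu : SqSummable p u) : SqSummable p (fun j t => c j * u j t) := by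
  refine ⟨fun j => (hu.memLp j).const_mul _, ?_⟩
  refine Summable.of_nonneg_of_le (fun j => mul_nonneg (j.weight_nonneg hp) (sqNorm_nonneg _))
    (fun j => ?_) (hu.summable.mul_left (M ^ 2))
  rw [sqNorm_const_mul, mul_left_comm]
  exact mul_le_mul_of_nonneg_right (pow_le_pow_left₀ (norm_nonneg _) (hc j) 2)
    (mul_nonneg (j.weight_nonneg hp) (sqNorm_nonneg _))

theorem summable_pairing (hp : ∀ l, 0 < p l) (hu : SqSummable p u) (hv : SqSummable p v) :
    Summable fun j : Edge T => (j.weight p : ℂ) * pairing (u j) (v j) := by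
  refine Summable.of_norm_bounded (hu.summable.add hv.summable) fun j => ?_
  rw [norm_mul, Complex.norm_real, Real.norm_of_nonneg (j.weight_nonneg hp), ← mul_add]
  exact mul_le_mul_of_nonneg_left (norm_pairing_le (hu.memLp j) (hv.memLp j)) (j.weight_nonneg hp)

end SqSummable

/-- The square of the norm of the weighted `L_2` space over all edges. -/
noncomputable def totalSqNorm (p : ℕ → ℝ) (u : Edge T → ℝ → ℂ) : ℝ :=
  ∑' j, j.weight p * sqNorm (u j)

/-- The inner product of the weighted `L_2` space over all edges. -/
noncomputable def totalPairing (p : ℕ → ℝ) (u v : Edge T → ℝ → ℂ) : ℂ :=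
  ∑' j, (j.weight p : ℂ) * pairing (u j) (v j)

theorem totalSqNorm_nonneg (hp : ∀ l, 0 < p l) (u : Edge T → ℝ → ℂ) : 0 ≤ totalSqNorm p u :=
  tsum_nonneg fun j => mul_nonneg (j.weight_nonneg hp) (sqNorm_nonneg _)

theorem totalSqNorm_add (hp : ∀ l, 0 < p l) {u v : Edge T → ℝ → ℂ} (hu : SqSummable p u)
    (hv : SqSummable p v) :
    totalSqNorm p (fun j t => u j t + v j t) =
      totalSqNorm p u + 2 * (totalPairing p u v).re + totalSqNorm p v := by
  have h := (Complex.hasSum_re (hu.summable_pairing hp hv).hasSum).mul_left 2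
  refine (((hu.summable.hasSum.add h).add hv.summable.hasSum).congr_fun fun j => ?_).tsum_eq
  rw [sqNorm_add (hu.memLp j) (hv.memLp j), Complex.re_ofReal_mul]
  ring

theorem totalSqNorm_const_mul (c : ℂ) (u : Edge T → ℝ → ℂ) :
    totalSqNorm p (fun j t => c * u j t) = ‖c‖ ^ 2 * totalSqNorm p u := by
  rw [totalSqNorm, totalSqNorm, ← tsum_mul_left]
  exact tsum_congr fun j => by rw [sqNorm_const_mul]; ring

theorem totalPairing_const_mul_right (c : ℂ) (u v : Edge T → ℝ → ℂ) :
    totalPairing p u (fun j t => c * v j t) = conj c * totalPairing p u v := by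
  rw [totalPairing, totalPairing, ← tsum_mul_left]
  exact tsum_congr fun j => by rw [pairing_const_mul_right]; ring

/-! ### The energy on the weighted Sobolev space -/

theorem memWeightedW_one_iff (hp : ∀ l, 0 < p l) {y : Edge T → ℝ → ℂ} :
    MemWeightedW p 1 y ↔
      (∀ j, MemW 1 (y j)) ∧ SqSummable p y ∧ SqSummable p (fun j => D (y j)) := by
  simp only [MemWeightedW, normSqW_one, mul_add]
  have hn (u : Edge T → ℝ → ℂ) (j : Edge T) : 0 ≤ j.weight p * sqNorm (u j) :=
    mul_nonneg (j.weight_nonneg hp) (sqNorm_nonneg _)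
  refine ⟨fun h => ⟨h.1, ⟨fun j => memLp_of_memW (h.1 j), ?_⟩,
    ⟨fun j => (memW_one_iff.1 (h.1 j)).2, ?_⟩⟩, fun h => ⟨h.1, h.2.1.summable.add h.2.2.summable⟩⟩
  · exact h.2.of_nonneg_of_le (hn _) fun j => le_add_of_nonneg_right (hn (fun j => D (y j)) j)
  · exact h.2.of_nonneg_of_le (hn _) fun j => le_add_of_nonneg_left (hn y j)

theorem memWeightedW_add_const_mul (hp : ∀ l, 0 < p l) {y z : Edge T → ℝ → ℂ}
    (hy : MemWeightedW p 1 y) (hz : MemWeightedW p 1 z) (c : ℂ) :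
    MemWeightedW p 1 (fun j t => y j t + c * z j t) := by
  rw [memWeightedW_one_iff hp] at *
  refine ⟨fun j => memW_add_const_mul (hy.1 j) (hz.1 j) c,
    hy.2.1.add hp (hz.2.1.coeff_mul hp (c := fun _ => c) fun _ => le_rfl),
    (hy.2.2.add hp (hz.2.2.coeff_mul hp (c := fun _ => c) fun _ => le_rfl)).congr fun j => ?_⟩
  exact (D_add_const_mul (hy.1 j) (hz.1 j) c).mono fun t ht => ht.symm

theorem sqSummable_ell (hp : ∀ l, 0 < p l) (hθ : BddAbove (Set.range fun l => ‖θ l‖))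
    {y : Edge T → ℝ → ℂ} (hy : MemWeightedW p 1 y) : SqSummable p (ell b₁ θ y) := by
  obtain ⟨M, hM⟩ := Edge.exists_norm_coeff_le (T := T) b₁ hθ
  rw [memWeightedW_one_iff hp] at hy
  exact hy.2.2.add hp (hy.2.1.coeff_mul hp hM)

/-- The energy is a quadratic functional on `W^1_{2,α}`. -/
theorem energy_add_const_mul (hp : ∀ l, 0 < p l) (hθ : BddAbove (Set.range fun l => ‖θ l‖))
    {y z : Edge T → ℝ → ℂ} (hy : MemWeightedW p 1 y) (hz : MemWeightedW p 1 z) (c : ℂ) :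
    energy p b₁ θ (fun j t => y j t + c * z j t) = energy p b₁ θ y
      + 2 * (conj c * totalPairing p (ell b₁ θ y) (ell b₁ θ z)).re
      + ‖c‖ ^ 2 * energy p b₁ θ z := by
  have h1 : energy p b₁ θ (fun j t => y j t + c * z j t) =
      totalSqNorm p (fun j t => ell b₁ θ y j t + c * ell b₁ θ z j t) := by
    refine tsum_congr fun j => congrArg _ (sqNorm_congr ?_)
    filter_upwards [D_add_const_mul (hy.1 j) (hz.1 j) c] with t ht
    simp only [ell, ht]; ring
  rw [h1, totalSqNorm_add hp (sqSummable_ell hp hθ hy)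
    ((sqSummable_ell hp hθ hz).coeff_mul hp (c := fun _ => c) fun _ => le_rfl),
    totalPairing_const_mul_right, totalSqNorm_const_mul]
  rfl

theorem Conditions.add_const_mul {hT : 0 < T} {φ₀ φ₁ : ℂ} {y z : Edge T → ℝ → ℂ}
    (hy : Conditions hT φ₀ φ₁ y) (hz : Conditions hT 0 0 z) (c : ℂ) :
    Conditions hT φ₀ φ₁ (fun j t => y j t + c * z j t) :=
  ⟨by simp [hy.initial, hz.initial],
    fun j h l => by simp only [hy.gluing j h l, hz.gluing j h l],
    fun j h => by simp [hy.terminal j h, hz.terminal j h]⟩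

/-- The first variation of the energy vanishes at a minimiser. -/
theorem SolvesV.totalPairing_eq_zero {hT : 0 < T} {φ₀ φ₁ : ℂ} {y : Edge T → ℝ → ℂ}
    (hy : SolvesV hT p b₁ θ φ₀ φ₁ y) (hp : ∀ l, 0 < p l)
    (hθ : BddAbove (Set.range fun l => ‖θ l‖)) {z : Edge T → ℝ → ℂ}
    (hz : MemWeightedW p 1 z) (hc : Conditions hT 0 0 z) :
    totalPairing p (ell b₁ θ y) (ell b₁ θ z) = 0 := by
  set B := totalPairing p (ell b₁ θ y) (ell b₁ θ z) with hB
  set E := energy p b₁ θ z with hE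
  have key (c : ℂ) : 0 ≤ 2 * (conj c * B).re + ‖c‖ ^ 2 * E := by
    have := hy.minimal _ (memWeightedW_add_const_mul hp hy.mem hz c)
      (hy.conditions.add_const_mul hc c)
    rw [energy_add_const_mul hp hθ hy.mem hz] at this
    linarith
  have hE0 : 0 ≤ E := totalSqNorm_nonneg hp _
  -- the choice `c = -B / (E + 1)` makes the right-hand side of `key` negative unless `B = 0`
  have h := key ((-(1 / (E + 1)) : ℝ) * B)
  rw [map_mul, Complex.conj_ofReal, mul_assoc, mul_comm (conj B), Complex.mul_conj,
    Complex.normSq_eq_norm_sq, ← Complex.ofReal_mul, Complex.ofReal_re, norm_mul, mul_pow,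
    Complex.norm_real, Real.norm_eq_abs, sq_abs] at h
  have h1 : 0 < E + 1 := by linarith
  have h2 : 2 * (-(1 / (E + 1)) * ‖B‖ ^ 2) + (-(1 / (E + 1))) ^ 2 * ‖B‖ ^ 2 * E =
      -(‖B‖ ^ 2 * ((E + 2) / (E + 1) ^ 2)) := by
    field_simp; ring
  rw [h2] at h
  have h3 : 0 < (E + 2) / (E + 1) ^ 2 := by positivity
  have h4 : ‖B‖ ^ 2 ≤ 0 := by
    by_contra hcon
    have := mul_pos (not_le.1 hcon) h3
    linarith
  exact norm_eq_zero.1 (pow_eq_zero_iff two_ne_zero |>.1 (le_antisymm h4 (sq_nonneg _)))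

/-! ### The combinatorics of the tree -/

theorem Edge.child_injective (j : Edge T) (h : j.IsInternal) : Function.Injective (j.child h) :=
  fun _ _ e => (List.cons.inj (congrArg Subtype.val e)).1

theorem Edge.child_ne_self (j : Edge T) (h : j.IsInternal) (l : ℕ) : j.child h l ≠ j := fun e => by
  simpa [Edge.child] using congrArg (fun i : Edge T => i.1.length) e

theorem Edge.mem_range_child {i j : Edge T} (h : j.IsInternal) (hne : i ≠ j)
    (ht : i.1.tail = j.1) : i ∈ range (j.child h) := by
  rcases i with ⟨_ | ⟨l, w⟩, hi⟩
  · exact absurd (Subtype.ext ht) hne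
  · exact ⟨l, Subtype.ext (by simpa [Edge.child] using ht.symm)⟩

/-- Every edge other than the root edge is a child of exactly one internal vertex. -/
theorem hasSum_child_iff (hT : 0 < T) {f : Edge T → ℂ} (h0 : f (Edge.root hT) = 0) {a : ℂ} :
    HasSum (fun q : {j : Edge T // j.IsInternal} × ℕ => f (q.1.1.child q.1.2 q.2)) a ↔
      HasSum f a := by
  refine Function.Injective.hasSum_iff
    (g := fun q : {j : Edge T // j.IsInternal} × ℕ => q.1.1.child q.1.2 q.2) ?_ ?_
  · rintro ⟨⟨j, hj⟩, l⟩ ⟨⟨j', hj'⟩, l'⟩ e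
    have e' := congrArg Subtype.val e
    simp only [Edge.child, List.cons.injEq] at e'
    obtain ⟨rfl, e2⟩ := e'
    obtain rfl := Subtype.ext e2
    rfl
  · rintro ⟨_ | ⟨l, w⟩, hw⟩ hn
    · exact h0
    · exact absurd ⟨(⟨⟨w, (Nat.lt_succ_self _).trans hw⟩, hw⟩, l), rfl⟩ hn

/-! ### Kirchhoff conditions and boundary terms -/

theorem summable_mul_of_bddAbove (hp : ∀ l, 0 < p l) (hp1 : Summable p)
    (hθ : BddAbove (Set.range fun l => ‖θ l‖)) : Summable fun l => (p l : ℂ) * θ l := by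
  obtain ⟨M, hM⟩ := hθ
  refine Summable.of_norm_bounded (hp1.mul_right M) fun l => ?_
  rw [norm_mul, Complex.norm_real, Real.norm_of_nonneg (hp l).le]
  exact mul_le_mul_of_nonneg_left (hM ⟨l, rfl⟩) (hp l).le

/-- The Kirchhoff-type condition says that the quasi-derivative `y' + b y` at the end of an edge is
the average of its values at the beginnings of the children. -/
theorem hasSum_ell_iff (hp : ∀ l, 0 < p l) (hp1 : Summable p)
    (hθ : BddAbove (Set.range fun l => ‖θ l‖)) {hT : 0 < T} {φ₀ φ₁ : ℂ} {y : Edge T → ℝ → ℂ}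
    (hc : Conditions hT φ₀ φ₁ y) (j : Edge T) (h : j.IsInternal) :
    HasSum (fun l => (p l : ℂ) * ell b₁ θ y (j.child h l) 0) (ell b₁ θ y j 1) ↔
      HasSum (fun l => (p l : ℂ) * D (y (j.child h l)) 0)
        (D (y j) 1 + beta p b₁ θ j h * y j 1) := by
  have hs : HasSum (fun l => (p l : ℂ) * θ l * y j 1) ((∑' l, (p l : ℂ) * θ l) * y j 1) :=
    (summable_mul_of_bddAbove hp hp1 hθ).hasSum.mul_right _
  have hval : ell b₁ θ y j 1 = (D (y j) 1 + beta p b₁ θ j h * y j 1)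
      + (∑' l, (p l : ℂ) * θ l) * y j 1 := by
    simp only [ell, beta, Edge.coeff, Edge.child]; ring
  have hterm (l : ℕ) : (p l : ℂ) * ell b₁ θ y (j.child h l) 0 =
      (p l : ℂ) * D (y (j.child h l)) 0 + (p l : ℂ) * θ l * y j 1 := by
    rw [hc.gluing j h l]
    simp only [ell, Edge.coeff, Edge.child]; ring
  simp only [hterm, hval]
  refine ⟨fun H => ?_, fun H => H.add hs⟩
  simpa using H.sub hs

/-- On an edge where the quasi-derivative of `y` satisfies `g' = conj b * g`, which is the
second-order equation for `y`, the first variation consists of boundary terms. -/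
theorem pairing_ell {y z : Edge T → ℝ → ℂ} {j : Edge T} (hy : MemW 2 (y j)) (hz : MemW 1 (z j))
    (hD : ∀ᵐ t ∂leb, D (ell b₁ θ y j) t = conj (j.coeff b₁ θ) * ell b₁ θ y j t) :
    pairing (ell b₁ θ y j) (ell b₁ θ z j) =
      ell b₁ θ y j 1 * conj (z j 1) - ell b₁ θ y j 0 * conj (z j 0) := by
  obtain ⟨h1, h2⟩ := memW_one_of_memW_two hy
  exact pairing_deriv_add (memW_one_iff.1 (memW_add_const_mul h2 h1 (j.coeff b₁ θ))).1
    (memW_one_iff.1 hz).1 hD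

theorem summable_weight_mul_norm_sq (hp : ∀ l, 0 < p l) {u : Edge T → ℝ → ℂ}
    (hu : ∀ j, MemW 1 (u j)) (hs : SqSummable p u) (hs' : SqSummable p fun j => D (u j)) {a : ℝ}
    (ha : a ∈ Icc (0 : ℝ) 1) : Summable fun j => j.weight p * ‖u j a‖ ^ 2 := by
  refine Summable.of_nonneg_of_le (fun j => mul_nonneg (j.weight_nonneg hp) (sq_nonneg _))
    (fun j => ?_) ((hs.summable.add hs'.summable).mul_left 2)
  have := mul_le_mul_of_nonneg_left (norm_sq_le_of_memW (hu j) ha) (j.weight_nonneg hp)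
  linarith

theorem summable_weight_mul_conj (hp : ∀ l, 0 < p l) {u v : Edge T → ℂ}
    (hu : Summable fun j => j.weight p * ‖u j‖ ^ 2)
    (hv : Summable fun j => j.weight p * ‖v j‖ ^ 2) :
    Summable fun j => (j.weight p : ℂ) * (u j * conj (v j)) := by
  refine Summable.of_norm_bounded (hu.add hv) fun j => ?_
  rw [norm_mul, Complex.norm_real, Real.norm_of_nonneg (j.weight_nonneg hp), ← mul_add, norm_mul,
    RCLike.norm_conj]
  refine mul_le_mul_of_nonneg_left ?_ (j.weight_nonneg hp)
  nlinarith [sq_nonneg (‖u j‖ - ‖v j‖), sq_nonneg ‖u j‖, sq_nonneg ‖v j‖]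

theorem memWeightedW_two_iff (hp : ∀ l, 0 < p l) {y : Edge T → ℝ → ℂ} :
    MemWeightedW p 2 y ↔ MemWeightedW p 1 y ∧ (∀ j, MemW 2 (y j)) ∧
      SqSummable p (fun j => D (D (y j))) := by
  rw [memWeightedW_one_iff hp]
  simp only [MemWeightedW, normSqW_two, mul_add]
  have hn (u : Edge T → ℝ → ℂ) (j : Edge T) : 0 ≤ j.weight p * sqNorm (u j) :=
    mul_nonneg (j.weight_nonneg hp) (sqNorm_nonneg _)
  constructor
  · intro h
    have hw (j : Edge T) := memW_one_of_memW_two (h.1 j)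
    refine ⟨⟨fun j => (hw j).1, ⟨fun j => memLp_of_memW (hw j).1, ?_⟩,
      ⟨fun j => memLp_of_memW (hw j).2, ?_⟩⟩, h.1, ⟨fun j => (memW_one_iff.1 (hw j).2).2, ?_⟩⟩
    all_goals
      refine h.2.of_nonneg_of_le (hn _) fun j => ?_
      have h1 := hn y j
      have h2 := hn (fun j => D (y j)) j
      have h3 := hn (fun j => D (D (y j))) j
      linarith
  · intro h
    exact ⟨h.2.1, (h.1.2.1.summable.add h.1.2.2.summable).add h.2.2.summable⟩

/-! ### Solutions of the boundary value problem are minimisers -/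

/-- The first variation of the energy vanishes at a solution of the boundary value problem: the
boundary terms cancel at each internal vertex by the Kirchhoff-type condition. The trace inequality
makes the series of boundary terms absolutely convergent, which justifies the regrouping. -/
theorem totalPairing_eq_zero_of_solvesB {hT : 0 < T} {φ₀ φ₁ : ℂ} {y z : Edge T → ℝ → ℂ}
    (hp : ∀ l, 0 < p l) (hp1 : Summable p) (hθ : BddAbove (Set.range fun l => ‖θ l‖))
    (hy2 : MemWeightedW p 2 y) (hy : SolvesB hT p b₁ θ φ₀ φ₁ y) (hz : MemWeightedW p 1 z)
    (hc : Conditions hT 0 0 z) : totalPairing p (ell b₁ θ y) (ell b₁ θ z) = 0 := by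
  obtain ⟨M, hM⟩ := Edge.exists_norm_coeff_le (T := T) b₁ hθ
  have hD (j : Edge T) := D_ell_of_equation (hy2.1 j) (hy.equation j)
  have hg (j : Edge T) : MemW 1 (ell b₁ θ y j) :=
    memW_add_const_mul (memW_one_of_memW_two (hy2.1 j)).2 (memW_one_of_memW_two (hy2.1 j)).1 _
  have hgs := sqSummable_ell (b₁ := b₁) hp hθ ((memWeightedW_two_iff hp).1 hy2).1
  have hgs' : SqSummable p fun j => D (ell b₁ θ y j) :=
    (hgs.coeff_mul hp (c := fun j => conj (j.coeff b₁ θ)) (M := M)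
      fun j => by rw [RCLike.norm_conj]; exact hM j).congr fun j => (hD j).mono fun t ht => ht.symm
  obtain ⟨hz1, hz2, hz3⟩ := (memWeightedW_one_iff hp).1 hz
  have hA {a : ℝ} (ha : a ∈ Icc (0 : ℝ) 1) :
      Summable fun j => (j.weight p : ℂ) * (ell b₁ θ y j a * conj (z j a)) :=
    summable_weight_mul_conj hp (summable_weight_mul_norm_sq hp hg hgs hgs' ha)
      (summable_weight_mul_norm_sq hp hz1 hz2 hz3 ha)
  have hA1 := hA (a := 1) (by simp)
  have hA0 := hA (a := 0) (by simp)
  -- summing the terms at the beginnings of the edges over the children of each internal vertex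
  -- gives the terms at the ends of the edges
  have hprod := (hasSum_child_iff hT (by simp [hc.initial])).2 hA0.hasSum
  have hint := hprod.prod_fiberwise (g := fun j : {j : Edge T // j.IsInternal} =>
      (j.1.weight p : ℂ) * (ell b₁ θ y j.1 1 * conj (z j.1 1))) fun j => by
    have hk := ((hasSum_ell_iff hp hp1 hθ hy.conditions j.1 j.2).2 (hy.kirchhoff j.1 j.2)).mul_left
      ((j.1.weight p : ℂ) * conj (z j.1 1))
    rw [show (j.1.weight p : ℂ) * (ell b₁ θ y j.1 1 * conj (z j.1 1)) =
      (j.1.weight p : ℂ) * conj (z j.1 1) * ell b₁ θ y j.1 1 by ring]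
    refine hk.congr_fun fun l => ?_
    rw [Edge.weight_child, ← hc.gluing j.1 j.2 l]
    push_cast; ring
  -- an edge that is not internal contributes nothing, since `z` vanishes at its end
  have hsum := (Subtype.val_injective.hasSum_iff
    (f := fun j : Edge T => (j.weight p : ℂ) * (ell b₁ θ y j 1 * conj (z j 1))) fun j hj => by
      have hb : j.IsBoundary := by
        have h1 : ¬ j.IsInternal := fun h => hj ⟨⟨j, h⟩, rfl⟩
        have h2 := j.2
        simp only [Edge.IsInternal, Edge.IsBoundary] at h1 ⊢
        omega
      simp [hc.terminal j hb]).1 hint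
  have hfin := (hA1.hasSum.sub hA0.hasSum).tsum_eq
  rw [hsum.tsum_eq, sub_self] at hfin
  rw [← hfin, totalPairing]
  refine tsum_congr fun j => ?_
  rw [pairing_ell (hy2.1 j) (hz1 j) (hD j)]
  ring

theorem solvesV_of_solvesB {hT : 0 < T} {φ₀ φ₁ : ℂ} {y : Edge T → ℝ → ℂ} (hp : ∀ l, 0 < p l)
    (hp1 : Summable p) (hθ : BddAbove (Set.range fun l => ‖θ l‖)) (hy2 : MemWeightedW p 2 y)
    (hy : SolvesB hT p b₁ θ φ₀ φ₁ y) : SolvesV hT p b₁ θ φ₀ φ₁ y := by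
  have hy1 := ((memWeightedW_two_iff hp).1 hy2).1
  refine ⟨hy1, hy.conditions, fun z hz hzc => ?_⟩
  set h : Edge T → ℝ → ℂ := fun j t => z j t + (-1) * y j t with hh
  have hh1 : MemWeightedW p 1 h := memWeightedW_add_const_mul hp hz hy1 (-1)
  have hhc : Conditions hT 0 0 h :=
    ⟨by simp [hh, hzc.initial, hy.conditions.initial],
      fun j hj l => by simp only [hh, hzc.gluing j hj l, hy.conditions.gluing j hj l],
      fun j hj => by simp [hh, hzc.terminal j hj, hy.conditions.terminal j hj]⟩
  have hzh : z = fun j t => y j t + 1 * h j t := by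
    funext j t; simp only [hh]; ring
  rw [hzh, energy_add_const_mul hp hθ hy1 hh1,
    totalPairing_eq_zero_of_solvesB hp hp1 hθ hy2 hy hh1 hhc]
  have : 0 ≤ energy p b₁ θ h := totalSqNorm_nonneg hp _
  simpa using this

/-! ### Minimisers solve the boundary value problem -/

theorem memW_zero : MemW 1 (fun _ => (0 : ℂ)) := memW_of_contDiff contDiff_const

theorem D_zero : D (fun _ => (0 : ℂ)) = fun _ => 0 := by
  funext t; simp [D]

theorem normSqW_zero : normSqW 1 (fun _ => (0 : ℂ)) = 0 := by
  rw [normSqW_one, D_zero]; simp [sqNorm]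

/-- A function on one edge that vanishes at both ends, extended by zero, is an admissible
variation. -/
theorem SolvesV.pairing_eq_zero {hT : 0 < T} {φ₀ φ₁ : ℂ} {y : Edge T → ℝ → ℂ}
    (hy : SolvesV hT p b₁ θ φ₀ φ₁ y) (hp : ∀ l, 0 < p l)
    (hθ : BddAbove (Set.range fun l => ‖θ l‖)) (j : Edge T) {h : ℝ → ℂ} (hh : MemW 1 h)
    (h0 : h 0 = 0) (h1 : h 1 = 0) :
    pairing (ell b₁ θ y j) (fun t => D h t + j.coeff b₁ θ * h t) = 0 := by
  classical
  set z : Edge T → ℝ → ℂ := fun i => if i = j then h else fun _ => 0 with hz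
  have hzj : z j = h := if_pos rfl
  have hzi {i : Edge T} (hi : i ≠ j) : z i = fun _ => 0 := if_neg hi
  have hz0 (i : Edge T) : z i 0 = 0 := by
    by_cases hi : i = j
    · rw [hi, hzj, h0]
    · rw [hzi hi]
  have hz1 (i : Edge T) : z i 1 = 0 := by
    by_cases hi : i = j
    · rw [hi, hzj, h1]
    · rw [hzi hi]
  have hzW : MemWeightedW p 1 z := by
    refine ⟨fun i => ?_, summable_of_ne_finset_zero (s := {j}) fun i hi => ?_⟩
    · by_cases hi : i = j
      · rw [hi, hzj]; exact hh
      · rw [hzi hi]; exact memW_zero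
    · rw [hzi (by simpa using hi), normSqW_zero, mul_zero]
  have key := hy.totalPairing_eq_zero hp hθ hzW
    ⟨hz0 _, fun i hi l => by rw [hz1, hz0], fun i _ => hz1 i⟩
  rw [totalPairing, tsum_eq_single j fun i hi => by
    simp only [ell, hzi hi, D_zero, pairing]; simp] at key
  have hw : (j.weight p : ℂ) ≠ 0 := Complex.ofReal_ne_zero.2 (j.weight_pos hp).ne'
  have := (mul_eq_zero.1 key).resolve_left hw
  have hell : ell b₁ θ z j = fun t => D h t + j.coeff b₁ θ * h t := by
    funext t; rw [ell, hzj]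
  rwa [hell] at this

/-- The tuple that increases linearly from `0` to `1` on the edge `j`, decreases linearly from `1`
to `0` on its children, and vanishes on all other edges. -/
noncomputable def hat (j : Edge T) : Edge T → ℝ → ℂ := by
  classical
  exact fun i => if i = j then fun t => (t : ℂ)
    else if i.1.tail = j.1 then fun t => 1 - (t : ℂ) else fun _ => 0

theorem hat_self (j : Edge T) : hat j j = fun t : ℝ => (t : ℂ) := if_pos rfl

theorem hat_child (j : Edge T) (h : j.IsInternal) (l : ℕ) :
    hat j (j.child h l) = fun t : ℝ => 1 - (t : ℂ) := by
  rw [hat, if_neg (j.child_ne_self h l)]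
  exact if_pos rfl

theorem hat_of_ne {i j : Edge T} (h : j.IsInternal) (hne : i ≠ j) (hi : i ∉ range (j.child h)) :
    hat j i = fun _ => 0 := by
  rw [hat, if_neg hne, if_neg fun ht => hi (Edge.mem_range_child h hne ht)]

theorem hat_conditions (hT : 0 < T) {j : Edge T} (h : j.IsInternal) :
    Conditions hT 0 0 (hat j) := by
  have hone {i : Edge T} (hne : i ≠ j) : hat j i 1 = 0 := by
    by_cases hi : i ∈ range (j.child h)
    · obtain ⟨l, rfl⟩ := hi
      simp [hat_child]
    · rw [hat_of_ne h hne hi]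
  have hzero {i : Edge T} (hi : i ∉ range (j.child h)) : hat j i 0 = 0 := by
    by_cases hne : i = j
    · subst hne; simp [hat_self]
    · rw [hat_of_ne h hne hi]
  refine ⟨hzero ?_, fun i hi l => ?_, fun i hi => hone ?_⟩
  · rintro ⟨l, hl⟩
    simpa [Edge.child, Edge.root] using congrArg Subtype.val hl
  · by_cases hij : i = j
    · subst hij; simp [hat_self, hat_child]
    · rw [hone hij, hzero]
      rintro ⟨l', hl⟩
      have := congrArg Subtype.val hl
      simp only [Edge.child, List.cons.injEq] at this
      exact hij (Subtype.ext this.2.symm)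
  · rintro rfl
    simp only [Edge.IsInternal, Edge.IsBoundary] at h hi
    omega

/-- The energy of the hat function is finite since the weights of the children of an edge add up to
a finite number. -/
theorem hat_memWeightedW (hp1 : Summable p) {j : Edge T} (h : j.IsInternal) :
    MemWeightedW p 1 (hat j) := by
  classical
  constructor
  · intro i
    by_cases hne : i = j
    · subst hne; rw [hat_self]; exact memW_of_contDiff Complex.ofRealCLM.contDiff
    by_cases hi : i ∈ range (j.child h)
    · obtain ⟨l, rfl⟩ := hi
      rw [hat_child]; exact memW_of_contDiff (contDiff_const.sub Complex.ofRealCLM.contDiff)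
    · rw [hat_of_ne h hne hi]; exact memW_zero
  · set F : Edge T → ℝ := fun i => i.weight p * normSqW 1 (hat j i) with hF
    have hG : Summable (Function.update F j 0) := by
      refine ((j.child_injective h).summable_iff fun i hi => ?_).1 ?_
      · by_cases hne : i = j
        · rw [hne, Function.update_self]
        · rw [Function.update_of_ne hne, hF]
          simp only [hat_of_ne h hne hi, normSqW_zero, mul_zero]
      · refine (hp1.mul_right (j.weight p * normSqW 1 fun t : ℝ => 1 - (t : ℂ))).congr fun l => ?_
        rw [Function.comp_apply, Function.update_of_ne (j.child_ne_self h l), hF]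
        simp only [hat_child, Edge.weight_child, mul_assoc]
    have := hG.update j (F j)
    rwa [Function.update_idem, Function.update_eq_self] at this

theorem solvesB_of_solvesV {hT : 0 < T} {φ₀ φ₁ : ℂ} {y : Edge T → ℝ → ℂ} (hp : ∀ l, 0 < p l)
    (hp1 : Summable p) (hθ : BddAbove (Set.range fun l => ‖θ l‖))
    (hy : SolvesV hT p b₁ θ φ₀ φ₁ y) : MemWeightedW p 2 y ∧ SolvesB hT p b₁ θ φ₀ φ₁ y := by
  classical
  obtain ⟨M, hM⟩ := Edge.exists_norm_coeff_le (T := T) b₁ hθ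
  have hell := sqSummable_ell (b₁ := b₁) hp hθ hy.mem
  have hexp (j : Edge T) := exists_eq_exp_of_pairing_eq_zero (hell.memLp j)
    fun h hh h0 h1 => hy.pairing_eq_zero hp hθ j hh h0 h1
  choose c hc using hexp
  have hreg (j : Edge T) := regular_of_ae_eq_exp (hy.mem.1 j) (hc j)
  have hmem : MemWeightedW p 2 y := by
    refine (memWeightedW_two_iff hp).2 ⟨hy.mem, fun j => (hreg j).1, ?_⟩
    obtain ⟨-, hs, hs'⟩ := (memWeightedW_one_iff hp).1 hy.mem
    refine ((hs'.coeff_mul hp (c := fun j => conj (j.coeff b₁ θ) - j.coeff b₁ θ) (M := M + M)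
      fun j => ?_).add hp (hs.coeff_mul hp
        (c := fun j => conj (j.coeff b₁ θ) * j.coeff b₁ θ) (M := M * M) fun j => ?_)).congr
      fun j => ?_
    · refine (norm_sub_le _ _).trans ?_
      rw [RCLike.norm_conj]
      exact add_le_add (hM j) (hM j)
    · rw [norm_mul, RCLike.norm_conj]
      exact mul_le_mul (hM j) (hM j) (norm_nonneg _) ((norm_nonneg _).trans (hM j))
    · filter_upwards [ae_restrict_mem measurableSet_Icc] with t ht
      exact ((hreg j).2 t ht).symm
  have heq (j : Edge T) : ∀ᵐ t ∂(volume.restrict (Ioo (0 : ℝ) 1)),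
      -D (D (y j)) t - 2 * Complex.I * ((j.coeff b₁ θ).im : ℂ) * D (y j) t
        + ((‖j.coeff b₁ θ‖ ^ 2 : ℝ) : ℂ) * y j t = 0 := by
    filter_upwards [ae_restrict_mem measurableSet_Ioo] with t ht
    rw [(hreg j).2 t (Ioo_subset_Icc_self ht), ← Complex.normSq_eq_norm_sq,
      ← Complex.mul_conj, show 2 * Complex.I * ((j.coeff b₁ θ).im : ℂ) =
        j.coeff b₁ θ - conj (j.coeff b₁ θ) by rw [Complex.sub_conj]; push_cast; ring]
    ring
  refine ⟨hmem, heq, hy.conditions, fun j h => ?_⟩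
  rw [← hasSum_ell_iff hp hp1 hθ hy.conditions j h]
  have hhat := hat_memWeightedW hp1 h
  set F : Edge T → ℂ := fun i => (i.weight p : ℂ) * pairing (ell b₁ θ y i) (ell b₁ θ (hat j) i)
    with hF
  have hpair (i : Edge T) : F i = (i.weight p : ℂ) *
      (ell b₁ θ y i 1 * conj (hat j i 1) - ell b₁ θ y i 0 * conj (hat j i 0)) := by
    rw [hF, ← pairing_ell (hmem.1 i) (hhat.1 i) (D_ell_of_equation (hmem.1 i) (heq i))]
  have hsum : HasSum F 0 := by
    have := (hell.summable_pairing hp (sqSummable_ell (b₁ := b₁) hp hθ hhat)).hasSum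
    have h0 := hy.totalPairing_eq_zero hp hθ hhat (hat_conditions hT h)
    rw [totalPairing] at h0
    rwa [h0] at this
  have hFj : F j = (j.weight p : ℂ) * ell b₁ θ y j 1 := by
    rw [hpair, hat_self]; simp
  -- without its term at `j` the vanishing sum runs over the children of `j` only
  have hup := hsum.update j 0
  rw [← (j.child_injective h).hasSum_iff fun i hi => by
    by_cases hne : i = j
    · rw [hne, Function.update_self]
    · rw [Function.update_of_ne hne, hpair, hat_of_ne h hne hi]; simp] at hup
  have hw : (j.weight p : ℂ) ≠ 0 := Complex.ofReal_ne_zero.2 (j.weight_pos hp).ne'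
  have hval : ell b₁ θ y j 1 = -(j.weight p : ℂ)⁻¹ * (0 - F j + 0) := by
    rw [hFj]; field_simp; ring
  rw [hval]
  refine (hup.mul_left (-(j.weight p : ℂ)⁻¹)).congr_fun fun l => ?_
  rw [Function.comp_apply, Function.update_of_ne (j.child_ne_self h l), hpair, hat_child,
    Edge.weight_child]
  simp only [Complex.ofReal_one, sub_self, map_zero, mul_zero, Complex.ofReal_zero, sub_zero,
    map_one, mul_one, zero_sub, Complex.ofReal_mul]
  field_simp

end TimeTree

theorem theorem1 {T : ℕ} (hT : 0 < T)
    (p : ℕ → ℝ) (hp : ∀ l, 0 < p l) (hp1 : HasSum p 1)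
    (θ : ℕ → ℂ) (hθ : BddAbove (Set.range fun l => ‖θ l‖))
    (b₁ φ₀ φ₁ : ℂ)
    (y : TimeTree.Edge T → ℝ → ℂ) (hy : TimeTree.MemWeightedW p 1 y) :
    TimeTree.SolvesV hT p b₁ θ φ₀ φ₁ y ↔
      TimeTree.MemWeightedW p 2 y ∧ TimeTree.SolvesB hT p b₁ θ φ₀ φ₁ y :=
  ⟨TimeTree.solvesB_of_solvesV hp hp1.summable hθ,
    fun h => TimeTree.solvesV_of_solvesB hp hp1.summable hθ h.1 h.2⟩
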